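/- All posets are finite. A meet-semilattice $\mathcal L$ with least element $\mathbf 0$ is called \emph{modular} if $[\mathbf 0,p]$ is a modular lattice for every $p\in\mathcal L$ and, for all $a,b,c$, the join $a\vee b\vee c$ exists whenever $a\vee b$, $b\vee c$, $c\vee a$ exist. A \emph{valuation} of $\mathcal L$ is a function $v:\mathcal L\to\mathbf R$ with $v(p)<v(q)$ for $p\prec q$ and $v(p)+v(q)=v(p\wedge q)+v(p\vee q)$ whenever $p\vee q$ exists; write $v[p,q]=v(q)-v(p)$ for $p\preceq q$. The \emph{distance function} $d=d_{\mathcal L}$ is the shortest-path metric of the covering graph (undirected Hasse diagram) of $\mathcal L$, where the edge joining $p$ to an element $q$ covering $p$ has length $v(q)-v(p)$; put $I(p,q)=\{u: d(p,u)+d(u,q)=d(p,q)\}$. For $p,q\in\mathcal L$ and $u\in I(p,q)$ let $v(u;p,q)=(v[p\wedge q,u\wedge p],\,v[p\wedge q,u\wedge q])\in\mathbf R^2_+$, let $\mathrm{Conv}\,I(p,q)$ be the convex hull of $\{v(u;p,q):u\in I(p,q)\}$, and let $\mathcal E(p,q)$ be the set of all $u\in I(p,q)$ such that $z=v(u;p,q)$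 is an extreme point of $\mathrm{Conv}\,I(p,q)$ and $z+\epsilon\notin\mathrm{Conv}\,I(p,q)$ for every vector $\epsilon$ with both coordinates positive. Let $C(u;p,q)$ be the cone of all $w\in\mathbf R^2_+$ with $\langle w,v(u;p,q)\rangle=\max_{u'\in I(p,q)}\langle w,v(u';p,q)\rangle$. A closed convex cone $C\ne\{0\}$ in $\mathbf R^2_+$ is uniquely of the form $\{(x,y)\in\mathbf R^2_+: -x\sin\alpha+y\cos\alpha\le 0,\ -x\sin\beta+y\cos\beta\ge 0\}$ with $0\le\beta\le\alpha\le\pi/2$; let $$[C]=\frac{\sin\alpha}{\cos\alpha+\sin\alpha}-\frac{\sin\beta}{\cos\beta+\sin\beta},\qquad [\{0\}]=0.$$ The formal sum $\sum_{u\in\mathcal E(p,q)}[C(u;p,q)]\,u$ is the \emph{fractional join} of $(p,q)$. A function $f:\mathcal L\to\mathbf R$ is \emph{submodular} on $\mathcal L$ with respect to $v$ if $$f(p)+f(q)\ \ge\ f(p\wedge q)+\sum_{u\in\mathcal E(p,q)}[C(u;p,q)]\,f(u)\qquad(p,q\in\mathcal L).$$ \textbf{Theorem.} Let $\mathcal L$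 be a modular semilattice with a valuation $v$. Equip the modular semilattice $\mathcal L\times\mathcal L$ with the componentwise order and the valuation $(p_1,p_2)\mapsto v(p_1)+v(p_2)$. Then the distance function $d_{\mathcal L}$, viewed as the function $(p_1,p_2)\mapsto d_{\mathcal L}(p_1,p_2)$, is submodular on $\mathcal L\times\mathcal L$. -/

import Mathlib

namespace ModularSemilattice

/-- A meet-semilattice with least element `⊥` is *modular* if every interval `[⊥, p]` is a modular
lattice and three elements have a join as soon as any two of them have a join. Joins are partial, so
they are expressed by `IsLUB`: in a meet-semilattice, the join of `a, b` computed in `[⊥, p]` is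
their join in the whole order. -/
structure IsModularSemilattice (L : Type*) [SemilatticeInf L] [OrderBot L] : Prop where
  exists_join : ∀ p a b : L, a ≤ p → b ≤ p → ∃ s, IsLUB {a, b} s
  modular_law : ∀ p a b c : L, a ≤ p → b ≤ p → c ≤ p → a ≤ c →
    ∀ s t : L, IsLUB {a, b ⊓ c} s → IsLUB {a, b} t → s = t ⊓ c
  exists_join_triple : ∀ a b c : L, (∃ s, IsLUB {a, b} s) → (∃ s, IsLUB {b, c} s) →
    (∃ s, IsLUB {c, a} s) → ∃ s, IsLUB {a, b, c} s

/-- A (positive) valuation: strictly increasing, and `v p + v q = v (p ∧ q) + v (p ∨ q)` whenever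
the join `p ∨ q` exists. -/
structure IsValuation {L : Type*} [SemilatticeInf L] (v : L → ℝ) : Prop where
  strictMono : StrictMono v
  modular_eq : ∀ p q s : L, IsLUB {p, q} s → v p + v q = v (p ⊓ q) + v s

section Metric

variable {L : Type*} [PartialOrder L]

/-- The length of a path of the covering graph: the edge joining `a` to an element `b` covering it
has length `v b - v a`. (The absolute value makes this symmetric in the two end points.) -/
noncomputable def pathLength (v : L → ℝ) {p q : L} (w : (SimpleGraph.hasse L).Walk p q) : ℝ :=
  (w.darts.map fun e => |v e.snd - v e.fst|).sum

/-- The shortest path metric of the covering graph, weighted by the valuation `v`. -/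
noncomputable def pathDist (v : L → ℝ) (p q : L) : ℝ :=
  ⨅ w : (SimpleGraph.hasse L).Walk p q, pathLength v w

/-- The metric interval `I(p, q)`. -/
def metricInterval (v : L → ℝ) (p q : L) : Set L :=
  {u | pathDist v p u + pathDist v u q = pathDist v p q}

end Metric

/-- The closed convex cone of the quarter plane between the rays of angles `β ≤ α`. -/
def sector (α β : ℝ) : Set (ℝ × ℝ) :=
  {z | 0 ≤ z.1 ∧ 0 ≤ z.2 ∧
    -z.1 * Real.sin α + z.2 * Real.cos α ≤ 0 ∧ 0 ≤ -z.1 * Real.sin β + z.2 * Real.cos β}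

open Classical in
/-- The number `[C]` attached to a closed convex cone `C` of the quarter plane: if `C ≠ {0}`, then
`C` is `sector α β` for unique `0 ≤ β ≤ α ≤ π / 2`, and `[C]` is given by the formula below
(it is independent of the choice, see `coneValue_sector`); `[{0}] = 0`. -/
noncomputable def coneValue (C : Set (ℝ × ℝ)) : ℝ :=
  if h : ∃ γ : ℝ × ℝ, 0 ≤ γ.2 ∧ γ.2 ≤ γ.1 ∧ γ.1 ≤ Real.pi / 2 ∧ C = sector γ.1 γ.2 then
    Real.sin h.choose.1 / (Real.cos h.choose.1 + Real.sin h.choose.1) -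
      Real.sin h.choose.2 / (Real.cos h.choose.2 + Real.sin h.choose.2)
  else 0

theorem mem_sector_iff {α β θ : ℝ} (hβ : 0 ≤ β) (hαβ : β ≤ α) (hα : α ≤ Real.pi / 2)
    (h0 : 0 ≤ θ) (h1 : θ ≤ Real.pi / 2) :
    ((Real.cos θ, Real.sin θ) : ℝ × ℝ) ∈ sector α β ↔ β ≤ θ ∧ θ ≤ α := by
  have hpi := Real.pi_pos
  have key : ∀ x y : ℝ, 0 ≤ x → x ≤ Real.pi / 2 → 0 ≤ y → y ≤ Real.pi / 2 →
      (0 ≤ -Real.cos x * Real.sin y + Real.sin x * Real.cos y ↔ y ≤ x) := by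
    intro x y hx hx' hy hy'
    have e : -Real.cos x * Real.sin y + Real.sin x * Real.cos y = Real.sin (x - y) := by
      rw [Real.sin_sub]; ring
    rw [e]
    constructor
    · intro h
      by_contra hlt
      have := Real.sin_neg_of_neg_of_neg_pi_lt (x := x - y) (by linarith) (by linarith)
      linarith
    · intro h
      exact Real.sin_nonneg_of_nonneg_of_le_pi (by linarith) (by linarith)
  have k1 := key θ β h0 h1 hβ (by linarith)
  have k2 := key α θ (by linarith) hα h0 h1
  have c0 : 0 ≤ Real.cos θ := Real.cos_nonneg_of_neg_pi_div_two_le_of_le (by linarith) h1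
  have s0 : 0 ≤ Real.sin θ := Real.sin_nonneg_of_nonneg_of_le_pi h0 (by linarith)
  simp only [sector, Set.mem_ofPred_eq]
  constructor
  · rintro ⟨-, -, h2, h3⟩
    exact ⟨k1.1 h3, k2.1 (by linarith)⟩
  · rintro ⟨h2, h3⟩
    have := k2.2 h3
    exact ⟨c0, s0, by linarith, k1.2 h2⟩

theorem sector_injective {α β α' β' : ℝ} (hβ : 0 ≤ β) (hαβ : β ≤ α) (hα : α ≤ Real.pi / 2)
    (hβ' : 0 ≤ β') (hαβ' : β' ≤ α') (hα' : α' ≤ Real.pi / 2)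
    (h : sector α β = sector α' β') : α = α' ∧ β = β' := by
  have A : ∀ θ, 0 ≤ θ → θ ≤ Real.pi / 2 → (β ≤ θ ∧ θ ≤ α ↔ β' ≤ θ ∧ θ ≤ α') := by
    intro θ h0 h1
    rw [← mem_sector_iff hβ hαβ hα h0 h1, h, mem_sector_iff hβ' hαβ' hα' h0 h1]
  have a1 := (A α (by linarith) hα).1 ⟨hαβ, le_rfl⟩
  have a2 := (A α' (by linarith) hα').2 ⟨hαβ', le_rfl⟩
  have b1 := (A β hβ (by linarith)).1 ⟨le_rfl, hαβ⟩
  have b2 := (A β' hβ' (by linarith)).2 ⟨le_rfl, hαβ'⟩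
  exact ⟨le_antisymm a1.2 a2.2, le_antisymm b2.1 b1.1⟩

theorem coneValue_sector {α β : ℝ} (hβ : 0 ≤ β) (hαβ : β ≤ α) (hα : α ≤ Real.pi / 2) :
    coneValue (sector α β) = Real.sin α / (Real.cos α + Real.sin α) -
      Real.sin β / (Real.cos β + Real.sin β) := by
  have h : ∃ γ : ℝ × ℝ, 0 ≤ γ.2 ∧ γ.2 ≤ γ.1 ∧ γ.1 ≤ Real.pi / 2 ∧
      sector α β = sector γ.1 γ.2 := ⟨(α, β), hβ, hαβ, hα, rfl⟩
  obtain ⟨g1, g2, g3, g4⟩ := h.choose_spec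
  obtain ⟨e1, e2⟩ := sector_injective hβ hαβ hα g1 g2 g3 g4
  rw [coneValue, dif_pos h, ← e1, ← e2]

section FractionalJoin

variable {L : Type*} [SemilatticeInf L]

/-- The vector `v(u; p, q) = (v[p ∧ q, u ∧ p], v[p ∧ q, u ∧ q])`, where `v[a, b] = v b - v a`. -/
def planePoint (v : L → ℝ) (p q u : L) : ℝ × ℝ :=
  (v (u ⊓ p) - v (p ⊓ q), v (u ⊓ q) - v (p ⊓ q))

/-- `Conv I(p, q)`: the convex hull of the image of the metric interval in the plane. -/
def convInterval (v : L → ℝ) (p q : L) : Set (ℝ × ℝ) :=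
  convexHull ℝ (planePoint v p q '' metricInterval v p q)

/-- The `(p, q)`-envelope: the elements of `I(p, q)` mapped to an extreme point `z` of
`Conv I(p, q)` that is maximal, i.e. `z + ε ∉ Conv I(p, q)` for every positive vector `ε`
(both coordinates positive). -/
def envelope (v : L → ℝ) (p q : L) : Set L :=
  {u | u ∈ metricInterval v p q ∧
    planePoint v p q u ∈ (convInterval v p q).extremePoints ℝ ∧
    ∀ ε : ℝ × ℝ, 0 < ε.1 → 0 < ε.2 → planePoint v p q u + ε ∉ convInterval v p q}

/-- The cone `C(u; p, q)` of the nonnegative vectors `w` for which `⟨w, v(u; p, q)⟩` is the maximum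
of `⟨w, v(u'; p, q)⟩` over `u' ∈ I(p, q)`; it is used for `u ∈ I(p, q)`. -/
def normalCone (v : L → ℝ) (p q u : L) : Set (ℝ × ℝ) :=
  {w | 0 ≤ w.1 ∧ 0 ≤ w.2 ∧ ∀ u' ∈ metricInterval v p q,
    w.1 * (planePoint v p q u').1 + w.2 * (planePoint v p q u').2 ≤
      w.1 * (planePoint v p q u).1 + w.2 * (planePoint v p q u).2}

open Classical in
/-- Submodularity of a (finite-valued) function `f` with respect to the valuation `v`:
`f(p) + f(q) ≥ f(p ∧ q) + ∑_{u ∈ E(p, q)} [C(u; p, q)] f(u)` for all `p, q`. -/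
def IsSubmodular [Fintype L] (v f : L → ℝ) : Prop :=
  ∀ p q : L, f (p ⊓ q) + ∑ u with u ∈ envelope v p q, coneValue (normalCone v p q u) * f u ≤
    f p + f q

end FractionalJoin

/-- The valuation of a product of two modular semilattices: the sum of their valuations. -/
def prodValuation {L₁ L₂ : Type*} (v₁ : L₁ → ℝ) (v₂ : L₂ → ℝ) (x : L₁ × L₂) : ℝ :=
  v₁ x.1 + v₂ x.2

end ModularSemilattice

namespace ModularSemilattice

/-! ### Modular semilattices with a valuation, and their products -/

open MeasureTheory

/-! Each number `[C]` is the length of the slice of the cone by the segment of points (1-t, t). The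
coefficient of `u` is thus the measure of those `t` in (0, 1] at which `u` maximizes (1-t)x + ty
over the plane points of I(p, q) (`coneValue_normalCone`). Off finitely many `t` the maximizer m(t)
is unique (`Metrized.maximizer_unique`), so the fractional join is the integral of m(t).

The potential (1-t) f(m(t) ∧ p) - t f(m(t) ∧ q) is f(p) at t = 0 and -f(q) at t = 1. Where m is a
constant u, it drops at rate f(u ∧ p) + f(u ∧ q). Hence `Metrized.isSubmodular` needs only that this
rate is at least f(u) + f(p ∧ q), and that the potential does not increase when m switches maximizer
at a fixed t.

The distance is v(p) + v(q) - 2v(p ∧ q) (`Metrized.pathDist_eq`). Its rate condition is the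
valuation inequality below u₁ ∧ u₂. For a switch, `Metrized.inf_change_le` bounds the change of the
meet term, one coordinate at a time. -/

/-- Two elements with a common upper bound. -/
def Bounded {M : Type*} [LE M] (a b : M) : Prop := ∃ c, a ≤ c ∧ b ≤ c

/-- What is used of a modular semilattice with a valuation: joins of bounded pairs exist and satisfy
the valuation equation, and pairwise bounded triples are bounded. -/
structure Metrized {M : Type*} [SemilatticeInf M] (v : M → ℝ) : Prop where
  strictMono : StrictMono v
  exists_join : ∀ a b c : M, a ≤ c → b ≤ c → ∃ s, a ≤ s ∧ b ≤ s ∧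
    (∀ d, a ≤ d → b ≤ d → s ≤ d) ∧ v a + v b = v (a ⊓ b) + v s
  bounded_triple : ∀ a b c : M, Bounded a b → Bounded b c → Bounded c a →
    ∃ d, a ≤ d ∧ b ≤ d ∧ c ≤ d

theorem IsValuation.metrized {L : Type*} [SemilatticeInf L] [OrderBot L]
    (hL : IsModularSemilattice L) {v : L → ℝ} (hv : IsValuation v) : Metrized v where
  strictMono := hv.strictMono
  exists_join a b c ha hb := by
    obtain ⟨s, hs⟩ := hL.exists_join c a b ha hb
    refine ⟨s, hs.1 (by simp), hs.1 (by simp), fun d h1 h2 => hs.2 ?_, hv.modular_eq a b s hs⟩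
    rintro x (rfl | rfl) <;> assumption
  bounded_triple a b c := by
    rintro ⟨x, ax, bx⟩ ⟨y, b_y, cy⟩ ⟨z, cz, az⟩
    obtain ⟨s, hs⟩ := hL.exists_join_triple a b c (hL.exists_join x a b ax bx)
      (hL.exists_join y b c b_y cy) (hL.exists_join z c a cz az)
    exact ⟨s, hs.1 (by simp), hs.1 (by simp), hs.1 (by simp)⟩

theorem Metrized.prod {L₁ L₂ : Type*} [SemilatticeInf L₁] [SemilatticeInf L₂] {v₁ : L₁ → ℝ}
    {v₂ : L₂ → ℝ} (h₁ : Metrized v₁) (h₂ : Metrized v₂) : Metrized (prodValuation v₁ v₂) where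
  strictMono a b hab := by
    unfold prodValuation
    rcases Prod.lt_iff.1 hab with ⟨h, h'⟩ | ⟨h, h'⟩
    · exact add_lt_add_of_lt_of_le (h₁.strictMono h) (h₂.strictMono.monotone h')
    · exact add_lt_add_of_le_of_lt (h₁.strictMono.monotone h) (h₂.strictMono h')
  exists_join a b c ha hb := by
    obtain ⟨s, as, bs, ls, es⟩ := h₁.exists_join a.1 b.1 c.1 ha.1 hb.1
    obtain ⟨t, a_t, bt, lt, et⟩ := h₂.exists_join a.2 b.2 c.2 ha.2 hb.2
    refine ⟨(s, t), ⟨as, a_t⟩, ⟨bs, bt⟩, fun d h h' => ⟨ls _ h.1 h'.1, lt _ h.2 h'.2⟩, ?_⟩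
    simp only [prodValuation, Prod.fst_inf, Prod.snd_inf]
    linarith
  bounded_triple a b c := by
    rintro ⟨x, ax, bx⟩ ⟨y, b_y, cy⟩ ⟨z, cz, az⟩
    obtain ⟨s, h1, h2, h3⟩ := h₁.bounded_triple a.1 b.1 c.1 ⟨x.1, ax.1, bx.1⟩ ⟨y.1, b_y.1, cy.1⟩
      ⟨z.1, cz.1, az.1⟩
    obtain ⟨t, h4, h5, h6⟩ := h₂.bounded_triple a.2 b.2 c.2 ⟨x.2, ax.2, bx.2⟩ ⟨y.2, b_y.2, cy.2⟩
      ⟨z.2, cz.2, az.2⟩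
    exact ⟨(s, t), ⟨h1, h4⟩, ⟨h2, h5⟩, ⟨h3, h6⟩⟩

/-! ### The distance through the valuation, and the metric interval -/

section Distance

variable {M : Type*} [SemilatticeInf M] {v : M → ℝ}

theorem Metrized.eq_of_le (hv : Metrized v) {a b : M} (h : a ≤ b) (h' : v b ≤ v a) : a = b := by
  rcases h.eq_or_lt with h | h
  · exact h
  · exact absurd (hv.strictMono h) (not_lt.2 h')

theorem Metrized.mono (hv : Metrized v) {a b : M} (h : a ≤ b) : v a ≤ v b :=
  hv.strictMono.monotone h

theorem Metrized.add_le (hv : Metrized v) {a b c : M} (ha : a ≤ c) (hb : b ≤ c) :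
    v a + v b ≤ v (a ⊓ b) + v c := by
  obtain ⟨s, -, -, h, e⟩ := hv.exists_join a b c ha hb
  have := hv.mono (h c ha hb)
  linarith

/-- The distance in terms of the valuation. -/
def valDist (v : M → ℝ) (p q : M) : ℝ := v p + v q - 2 * v (p ⊓ q)

theorem Metrized.valDist_triangle (hv : Metrized v) (p q r : M) :
    valDist v p r ≤ valDist v p q + valDist v q r := by
  have h := hv.add_le (inf_le_right : p ⊓ q ≤ q) (inf_le_left : q ⊓ r ≤ q)
  have h' : v (p ⊓ q ⊓ (q ⊓ r)) ≤ v (p ⊓ r) :=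
    hv.mono (le_inf (inf_le_left.trans inf_le_left) (inf_le_right.trans inf_le_right))
  unfold valDist
  linarith

theorem Metrized.valDist_of_adj (hv : Metrized v) {p q : M} (h : (SimpleGraph.hasse M).Adj p q) :
    valDist v p q = |v q - v p| := by
  rw [SimpleGraph.hasse_adj] at h
  unfold valDist
  rcases h with h | h
  · rw [inf_eq_left.2 h.le, abs_of_nonneg (sub_nonneg.2 (hv.mono h.le))]; ring
  · rw [inf_eq_right.2 h.le, abs_of_nonpos (sub_nonpos.2 (hv.mono h.le))]; ring

theorem Metrized.valDist_le_pathLength (hv : Metrized v) {p q : M}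
    (w : (SimpleGraph.hasse M).Walk p q) : valDist v p q ≤ pathLength v w := by
  induction w with
  | nil => simp [valDist, pathLength]; linarith
  | @cons a b c h w ih =>
    have := hv.valDist_triangle a b c
    rw [hv.valDist_of_adj h] at this
    simp only [pathLength, SimpleGraph.Walk.darts_cons, List.map_cons, List.sum_cons] at ih ⊢
    linarith

theorem pathLength_append {p q r : M} (w : (SimpleGraph.hasse M).Walk p q)
    (w' : (SimpleGraph.hasse M).Walk q r) :
    pathLength v (w.append w') = pathLength v w + pathLength v w' := by
  simp [pathLength, SimpleGraph.Walk.darts_append]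

theorem pathLength_reverse {p q : M} (w : (SimpleGraph.hasse M).Walk p q) :
    pathLength v w.reverse = pathLength v w := by
  simp only [pathLength, SimpleGraph.Walk.darts_reverse, List.map_reverse, List.sum_reverse,
    List.map_map]
  congr 2
  ext e
  simp [abs_sub_comm]

theorem Metrized.exists_walk_of_le [Finite M] (hv : Metrized v) {p q : M} (h : p ≤ q) :
    ∃ w : (SimpleGraph.hasse M).Walk p q, pathLength v w = v q - v p := by
  classical
  have := Fintype.ofFinite M
  let := Fintype.toLocallyFiniteOrder (α := M)
  have h' := le_iff_reflTransGen_covBy.1 h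
  clear h
  induction h' using Relation.ReflTransGen.head_induction_on with
  | refl => exact ⟨.nil, by simp [pathLength]⟩
  | @head a b hab _ ih =>
    obtain ⟨w, hw⟩ := ih
    refine ⟨.cons (SimpleGraph.hasse_adj.2 (Or.inl hab)) w, ?_⟩
    simp only [pathLength, SimpleGraph.Walk.darts_cons, List.map_cons, List.sum_cons] at hw ⊢
    rw [hw, abs_of_nonneg (sub_nonneg.2 (hv.mono hab.le))]
    ring

/-- Descending from `p` to `p ⊓ q` and climbing to `q` is optimal: by the triangle inequality no
walk is shorter than `valDist`. -/
theorem Metrized.pathDist_eq [Finite M] (hv : Metrized v) (p q : M) :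
    pathDist v p q = valDist v p q := by
  obtain ⟨w₁, h₁⟩ := hv.exists_walk_of_le (inf_le_left : p ⊓ q ≤ p)
  obtain ⟨w₂, h₂⟩ := hv.exists_walk_of_le (inf_le_right : p ⊓ q ≤ q)
  have hw : pathLength v (w₁.reverse.append w₂) = valDist v p q := by
    rw [pathLength_append, pathLength_reverse, h₁, h₂, valDist]; ring
  have : Nonempty ((SimpleGraph.hasse M).Walk p q) := ⟨w₁.reverse.append w₂⟩
  refine le_antisymm ?_ (le_ciInf fun w => hv.valDist_le_pathLength w)
  rw [← hw]
  exact ciInf_le ⟨valDist v p q, by rintro _ ⟨w, rfl⟩; exact hv.valDist_le_pathLength w⟩ _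

theorem Metrized.mem_interval_iff [Finite M] (hv : Metrized v) {p q u : M} :
    u ∈ metricInterval v p q ↔ v (u ⊓ p) + v (u ⊓ q) = v u + v (p ⊓ q) := by
  simp only [metricInterval, Set.mem_ofPred_eq, hv.pathDist_eq, valDist, inf_comm p u]
  constructor <;> intro h <;> linarith

theorem Metrized.interval_symm [Finite M] (hv : Metrized v) {p q u : M}
    (h : u ∈ metricInterval v p q) : u ∈ metricInterval v q p := by
  rw [hv.mem_interval_iff] at h ⊢
  rw [inf_comm q p]; linarith

theorem Metrized.left_mem_interval [Finite M] (hv : Metrized v) (p q : M) :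
    p ∈ metricInterval v p q := by
  rw [hv.mem_interval_iff, inf_idem]

theorem Metrized.inf_le_of_mem [Finite M] (hv : Metrized v) {p q u : M}
    (hu : u ∈ metricInterval v p q) : p ⊓ q ≤ u := by
  rw [hv.mem_interval_iff] at hu
  have h := hv.add_le (inf_le_left : u ⊓ p ≤ u) (inf_le_left : u ⊓ q ≤ u)
  have h1 : u ⊓ p ⊓ (u ⊓ q) ≤ p ⊓ q :=
    le_inf (inf_le_left.trans inf_le_right) (inf_le_right.trans inf_le_right)
  rw [← hv.eq_of_le h1 (by linarith)]
  exact inf_le_left.trans inf_le_left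

/-- The join of `u ⊓ p` and `u ⊓ q` has the same valuation as `u`, hence is `u`. -/
theorem Metrized.le_of_mem [Finite M] (hv : Metrized v) {p q u d : M}
    (hu : u ∈ metricInterval v p q) (hp : u ⊓ p ≤ d) (hq : u ⊓ q ≤ d) : u ≤ d := by
  have hm := hv.inf_le_of_mem hu
  rw [hv.mem_interval_iff] at hu
  obtain ⟨s, -, -, h, e⟩ := hv.exists_join (u ⊓ p) (u ⊓ q) u inf_le_left inf_le_left
  have e' : u ⊓ p ⊓ (u ⊓ q) = p ⊓ q :=
    le_antisymm (le_inf (inf_le_left.trans inf_le_right) (inf_le_right.trans inf_le_right))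
      (le_inf (le_inf hm inf_le_left) (le_inf hm inf_le_right))
  rw [e'] at e
  rw [← hv.eq_of_le (h u inf_le_left inf_le_left) (by linarith)]
  exact h d hp hq

/-- An element of the metric interval is determined by its meets with the end points. -/
theorem Metrized.eq_of_mem [Finite M] (hv : Metrized v) {p q u w : M}
    (hu : u ∈ metricInterval v p q) (hw : w ∈ metricInterval v p q) (hp : u ⊓ p = w ⊓ p)
    (hq : u ⊓ q = w ⊓ q) : u = w :=
  le_antisymm (hv.le_of_mem hu (hp ▸ inf_le_left) (hq ▸ inf_le_left))
    (hv.le_of_mem hw (hp ▸ inf_le_left) (hq ▸ inf_le_left))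

/-- The join of a bounded pair below the end points lies in the metric interval. -/
theorem Metrized.exists_mem_interval [Finite M] (hv : Metrized v) {p q a b : M} (hap : a ≤ p)
    (hbq : b ≤ q) (ha : p ⊓ q ≤ a) (hb : p ⊓ q ≤ b) (hab : Bounded a b) :
    ∃ u ∈ metricInterval v p q, u ⊓ p = a ∧ u ⊓ q = b := by
  obtain ⟨c, hac, hbc⟩ := hab
  obtain ⟨s, as, bs, h, e⟩ := hv.exists_join a b c hac hbc
  have hm : a ⊓ b = p ⊓ q := le_antisymm (inf_le_inf hap hbq) (le_inf ha hb)
  -- Here `v (s ⊓ p) + v b ≤ v (p ⊓ q) + v s = v a + v b`, so `s ⊓ p` cannot exceed `a`; the other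
  -- side is symmetric.
  have h1 := hv.add_le (inf_le_left : s ⊓ p ≤ s) bs
  have h2 := hv.add_le (inf_le_left : s ⊓ q ≤ s) as
  have m1 : v (s ⊓ p ⊓ b) ≤ v (p ⊓ q) :=
    hv.mono (le_inf (inf_le_left.trans inf_le_right) (inf_le_right.trans hbq))
  have m2 : v (s ⊓ q ⊓ a) ≤ v (p ⊓ q) :=
    hv.mono (le_inf (inf_le_right.trans hap) (inf_le_left.trans inf_le_right))
  rw [hm] at e
  have e1 := hv.eq_of_le (le_inf as hap) (by linarith)
  have e2 := hv.eq_of_le (le_inf bs hbq) (by linarith)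
  refine ⟨s, ?_, e1.symm, e2.symm⟩
  rw [hv.mem_interval_iff, ← e1, ← e2]
  linarith

/-- Uncrossing: join on the `p` side, meet on the `q` side. The meet is bounded with `u ⊓ p` through
`u` and with `w ⊓ p` through `w`, so the triple condition applies. -/
theorem Metrized.exists_exchange [Finite M] (hv : Metrized v) {p q u w : M}
    (hu : u ∈ metricInterval v p q) (hw : w ∈ metricInterval v p q) :
    ∃ e ∈ metricInterval v p q, v (e ⊓ p) = v (u ⊓ p) + v (w ⊓ p) - v (u ⊓ p ⊓ (w ⊓ p)) ∧
      e ⊓ q = u ⊓ q ⊓ (w ⊓ q) := by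
  have mu := hv.inf_le_of_mem hu
  have mw := hv.inf_le_of_mem hw
  obtain ⟨s, us, ws, hs, e⟩ := hv.exists_join (u ⊓ p) (w ⊓ p) p inf_le_right inf_le_right
  obtain ⟨d, h1, h2, h3⟩ := hv.bounded_triple (u ⊓ p) (w ⊓ p) (u ⊓ q ⊓ (w ⊓ q))
    ⟨p, inf_le_right, inf_le_right⟩ ⟨w, inf_le_left, inf_le_right.trans inf_le_left⟩
    ⟨u, inf_le_left.trans inf_le_left, inf_le_left⟩
  obtain ⟨x, hx, xp, xq⟩ := hv.exists_mem_interval (a := s) (b := u ⊓ q ⊓ (w ⊓ q))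
    (hs p inf_le_right inf_le_right) (inf_le_left.trans inf_le_right)
    ((le_inf mu inf_le_left).trans us)
    (le_inf (le_inf mu inf_le_right) (le_inf mw inf_le_right)) ⟨d, hs d h1 h2, h3⟩
  exact ⟨x, hx, by rw [xp]; linarith, xq⟩

end Distance

/-! ### Cone values as lengths of slices -/

theorem exists_angle {r : ℝ} (h0 : 0 ≤ r) (h1 : r ≤ 1) :
    ∃ θ ρ : ℝ, 0 ≤ θ ∧ θ ≤ Real.pi / 2 ∧ 0 < ρ ∧ Real.cos θ = (1 - r) * ρ ∧
      Real.sin θ = r * ρ := by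
  have hpos : ∀ θ ∈ Set.Icc 0 (Real.pi / 2), 0 < Real.cos θ + Real.sin θ := by
    intro θ hθ
    have c0 := Real.cos_nonneg_of_neg_pi_div_two_le_of_le (by linarith [hθ.1, Real.pi_pos]) hθ.2
    have s0 := Real.sin_nonneg_of_nonneg_of_le_pi hθ.1 (by linarith [hθ.2, Real.pi_pos])
    nlinarith [Real.sin_sq_add_cos_sq θ]
  have hc : ContinuousOn (fun θ => Real.sin θ / (Real.cos θ + Real.sin θ))
      (Set.Icc 0 (Real.pi / 2)) :=
    Real.continuous_sin.continuousOn.div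
      (Real.continuous_cos.add Real.continuous_sin).continuousOn fun θ hθ => (hpos θ hθ).ne'
  obtain ⟨θ, hθ, e⟩ := intermediate_value_Icc (by positivity) hc
    (show r ∈ Set.Icc _ _ by simpa using ⟨h0, h1⟩)
  have := hpos θ hθ
  have e' : Real.sin θ = r * (Real.cos θ + Real.sin θ) := by
    rw [← e]; field_simp
  exact ⟨θ, _, hθ.1, hθ.2, this, by linarith, e'⟩

/-- The slice of a cone by the segment from `(1, 0)` to `(0, 1)`. -/
def coneSlice (C : Set (ℝ × ℝ)) : Set ℝ := {t | (1 - t, t) ∈ C}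

/-- The ray of angle θ meets the segment x + y = 1 at height sin θ / (cos θ + sin θ), and a cone is
recovered from its slice by scaling. -/
theorem coneValue_eq_sub {C : Set (ℝ × ℝ)} (hC : ∀ w ∈ C, 0 ≤ w.1 ∧ 0 ≤ w.2)
    (hsmul : ∀ w ∈ C, ∀ c : ℝ, 0 ≤ c → (c * w.1, c * w.2) ∈ C) {l r : ℝ} (h0 : 0 ≤ l)
    (hlr : l ≤ r) (h1 : r ≤ 1) (h : coneSlice C = Set.Icc l r) : coneValue C = r - l := by
  obtain ⟨α, ρ, α0, α1, hρ, cα, sα⟩ := exists_angle (h0.trans hlr) h1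
  obtain ⟨β, σ, β0, β1, hσ, cβ, sβ⟩ := exists_angle h0 (hlr.trans h1)
  have hβα : β ≤ α := by
    by_contra hlt
    have h2 := Real.sin_neg_of_neg_of_neg_pi_lt (x := α - β) (by linarith)
      (by linarith [Real.pi_pos])
    rw [Real.sin_sub, cα, sα, cβ, sβ] at h2
    have : 0 ≤ (ρ * σ) * (r - l) := mul_nonneg (by positivity) (by linarith)
    linarith
  have key : ∀ t, t ∈ coneSlice C ↔ l ≤ t ∧ t ≤ r := fun t => by rw [h]; rfl
  have hl := (key l).2 ⟨le_rfl, hlr⟩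
  have e : C = sector α β := by
    ext ⟨x, y⟩
    simp only [sector, Set.mem_ofPred_eq, cα, sα, cβ, sβ]
    have i1 : -x * (r * ρ) + y * ((1 - r) * ρ) = ρ * (y - r * (x + y)) := by ring
    have i2 : -x * (l * σ) + y * ((1 - l) * σ) = σ * (y - l * (x + y)) := by ring
    rw [i1, i2, mul_nonneg_iff_of_pos_left hσ, ← neg_nonneg, ← mul_neg,
      mul_nonneg_iff_of_pos_left hρ]
    have hw : ∀ x y : ℝ, 0 < x + y →
        ((x, y) ∈ C ↔ l ≤ y / (x + y) ∧ y / (x + y) ≤ r) := by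
      intro x y hxy
      rw [← key]
      constructor
      · intro hm
        have := hsmul _ hm (1 / (x + y)) (by positivity)
        have e1 : 1 - y / (x + y) = 1 / (x + y) * x := by field_simp; ring
        have e2 : y / (x + y) = 1 / (x + y) * y := by ring
        rw [coneSlice, Set.mem_ofPred_eq, e1, e2]
        exact this
      · intro hm
        have := hsmul _ hm (x + y) hxy.le
        have e1 : (x + y) * (1 - y / (x + y)) = x := by field_simp; ring
        have e2 : (x + y) * (y / (x + y)) = y := by field_simp
        simpa only [e1, e2] using this
    constructor
    · intro hm
      obtain ⟨hx, hy⟩ := hC _ hm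
      simp only at hx hy
      refine ⟨hx, hy, ?_⟩
      rcases (add_nonneg hx hy).eq_or_lt with h' | h'
      · rw [← h']; constructor <;> linarith
      · have := (hw x y h').1 hm
        rw [le_div_iff₀ h', div_le_iff₀ h'] at this
        constructor <;> linarith
    · rintro ⟨hx, hy, h2, h3⟩
      rcases (add_nonneg hx hy).eq_or_lt with h' | h'
      · have := hsmul _ hl 0 le_rfl
        have hx0 : x = 0 := by linarith
        have hy0 : y = 0 := by linarith
        simpa [hx0, hy0] using this
      · rw [hw x y h', le_div_iff₀ h', div_le_iff₀ h']
        constructor <;> linarith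
  rw [e, coneValue_sector β0 hβα α1, cα, sα, cβ, sβ]
  field_simp
  ring

theorem coneValue_eq_zero {C : Set (ℝ × ℝ)}
    (hsmul : ∀ w ∈ C, ∀ c : ℝ, 0 ≤ c → (c * w.1, c * w.2) ∈ C) (h : coneSlice C = ∅) :
    coneValue C = 0 := by
  rw [coneValue, dif_neg]
  rintro ⟨⟨α, β⟩, β0, hαβ, α1, e⟩
  simp only at β0 hαβ α1 e
  have hβ := (mem_sector_iff β0 hαβ α1 β0 (by linarith)).2 ⟨le_rfl, hαβ⟩
  have c0 := Real.cos_nonneg_of_neg_pi_div_two_le_of_le (x := β) (by linarith [Real.pi_pos])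
    (by linarith)
  have s0 := Real.sin_nonneg_of_nonneg_of_le_pi β0 (by linarith [Real.pi_pos])
  have hp : 0 < Real.cos β + Real.sin β := by nlinarith [Real.sin_sq_add_cos_sq β]
  rw [← e] at hβ
  have h2 := hsmul _ hβ (1 / (Real.cos β + Real.sin β)) (by positivity)
  have : Real.sin β / (Real.cos β + Real.sin β) ∈ coneSlice C := by
    rw [coneSlice, Set.mem_ofPred_eq]
    have e1 : 1 - Real.sin β / (Real.cos β + Real.sin β) =
      1 / (Real.cos β + Real.sin β) * Real.cos β := by field_simp; ring
    have e2 : Real.sin β / (Real.cos β + Real.sin β) =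
      1 / (Real.cos β + Real.sin β) * Real.sin β := by ring
    rw [e1, e2]
    exact h2
  rw [h] at this
  exact this

/-- The number of a cone is the length of its slice. -/
theorem coneValue_eq_volume {C : Set (ℝ × ℝ)} (hC : ∀ w ∈ C, 0 ≤ w.1 ∧ 0 ≤ w.2)
    (hsmul : ∀ w ∈ C, ∀ c : ℝ, 0 ≤ c → (c * w.1, c * w.2) ∈ C) (hconv : Convex ℝ C)
    (hclosed : IsClosed C) : coneValue C = volume.real (coneSlice C ∩ Set.Ioc 0 1) := by
  have hsub : coneSlice C ⊆ Set.Icc 0 1 := fun t ht => by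
    have := hC _ ht
    exact ⟨this.2, by linarith [this.1]⟩
  have hcl : IsClosed (coneSlice C) := hclosed.preimage (by fun_prop)
  rcases (coneSlice C).eq_empty_or_nonempty with he | hne
  · rw [coneValue_eq_zero hsmul he, he]; simp
  · have hcv : Convex ℝ (coneSlice C) := by
      intro s hs t ht a b ha hb hab
      have := hconv hs ht ha hb hab
      rw [coneSlice, Set.mem_ofPred_eq]
      convert this using 1
      ext <;> simp
      linear_combination (-1 : ℝ) * hab
    have hcpt : IsCompact (coneSlice C) := isCompact_Icc.of_isClosed_subset hcl hsub
    have hI := eq_Icc_of_connected_compact ⟨hne, hcv.isPreconnected⟩ hcpt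
    have hle : sInf (coneSlice C) ≤ sSup (coneSlice C) :=
      csInf_le_csSup hne hcpt.bddBelow hcpt.bddAbove
    have hl := hsub (hcpt.sInf_mem hne)
    have hr := hsub (hcpt.sSup_mem hne)
    rw [coneValue_eq_sub hC hsmul hl.1 hle hr.2 hI]
    -- Half-open intervals lose only a null set and can later be concatenated.
    have : volume.real (coneSlice C ∩ Set.Ioc 0 1) = volume.real (coneSlice C ∩ Set.Icc 0 1) :=
      measureReal_congr ((ae_eq_refl _).inter Ioc_ae_eq_Icc)
    rw [this, Set.inter_eq_left.2 hsub]
    conv_rhs => rw [hI]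
    rw [Real.volume_real_Icc_of_le hle]

/-! ### Maximizers of the functionals with weights (1-t, t) -/

section Maximizers

variable {M : Type*} [SemilatticeInf M] {v : M → ℝ} {p q : M}

/-- The value of the linear functional with weights `(1 - t, t)` at the plane point of `u`. -/
def sliceValue (v : M → ℝ) (p q : M) (t : ℝ) (u : M) : ℝ :=
  (1 - t) * (planePoint v p q u).1 + t * (planePoint v p q u).2

/-- The maximizers over the metric interval of the linear functional with weights `(1 - t, t)`. -/
def maximizers (v : M → ℝ) (p q : M) (t : ℝ) : Set M :=
  {u | u ∈ metricInterval v p q ∧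
    ∀ w ∈ metricInterval v p q, sliceValue v p q t w ≤ sliceValue v p q t u}

theorem coneValue_normalCone {u : M} (hu : u ∈ metricInterval v p q) :
    coneValue (normalCone v p q u) = volume.real ({t | u ∈ maximizers v p q t} ∩ Set.Ioc 0 1) := by
  rw [coneValue_eq_volume (fun w hw => ⟨hw.1, hw.2.1⟩)]
  · congr 1
    ext t
    simp only [coneSlice, normalCone, maximizers, sliceValue, Set.mem_inter_iff,
      Set.mem_ofPred_eq, Set.mem_Ioc]
    constructor
    · rintro ⟨⟨-, -, h⟩, ht⟩
      exact ⟨⟨hu, h⟩, ht⟩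
    · rintro ⟨⟨-, h⟩, ht⟩
      exact ⟨⟨by linarith [ht.2], ht.1.le, h⟩, ht⟩
  · rintro w ⟨h1, h2, h3⟩ c hc
    refine ⟨mul_nonneg hc h1, mul_nonneg hc h2, fun u' hu' => ?_⟩
    have := mul_le_mul_of_nonneg_left (h3 u' hu') hc
    simp only
    linarith
  · rintro w ⟨h1, h2, h3⟩ w' ⟨h1', h2', h3'⟩ a b ha hb -
    refine ⟨?_, ?_, fun u' hu' => ?_⟩
    · simp only [Prod.fst_add, Prod.smul_fst, smul_eq_mul]; positivity
    · simp only [Prod.snd_add, Prod.smul_snd, smul_eq_mul]; positivity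
    · have e1 := mul_le_mul_of_nonneg_left (h3 u' hu') ha
      have e2 := mul_le_mul_of_nonneg_left (h3' u' hu') hb
      simp only [Prod.fst_add, Prod.snd_add, Prod.smul_fst, Prod.smul_snd, smul_eq_mul]
      linarith
  · have : normalCone v p q u = {w | 0 ≤ w.1} ∩ ({w | 0 ≤ w.2} ∩
        ⋂ u' ∈ metricInterval v p q, {w : ℝ × ℝ |
          w.1 * (planePoint v p q u').1 + w.2 * (planePoint v p q u').2 ≤
          w.1 * (planePoint v p q u).1 + w.2 * (planePoint v p q u).2}) := by
      ext w; simp [normalCone]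
    rw [this]
    refine (isClosed_le (by fun_prop) (by fun_prop)).inter
      ((isClosed_le (by fun_prop) (by fun_prop)).inter ?_)
    exact isClosed_biInter fun u' _ => isClosed_le (by fun_prop) (by fun_prop)

end Maximizers

/-! ### A criterion for submodularity -/

section Criterion

variable {M : Type*} [SemilatticeInf M] {v : M → ℝ} {p q : M}

/-- Exchange both ways and test one result at `s`, the other at `t`. The two inequalities add up to
`t - s` times a sum of two nonnegative defects being at most 0, so both defects vanish. -/
theorem Metrized.maximizers_mono [Finite M] (hv : Metrized v) {s t : ℝ} (hst : s < t) {u w : M}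
    (hu : u ∈ maximizers v p q s) (hw : w ∈ maximizers v p q t) :
    w ⊓ p ≤ u ⊓ p ∧ u ⊓ q ≤ w ⊓ q := by
  obtain ⟨x, hx, xp, xq⟩ := hv.exists_exchange hu.1 hw.1
  obtain ⟨y, hy, yq, yp⟩ := hv.exists_exchange (hv.interval_symm hu.1) (hv.interval_symm hw.1)
  have h1 := hu.2 x hx
  have h2 := hw.2 y (hv.interval_symm hy)
  simp only [sliceValue, planePoint, xp, xq, yp, yq] at h1 h2
  have h3 := hv.mono (inf_le_right : u ⊓ p ⊓ (w ⊓ p) ≤ w ⊓ p)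
  have h4 := hv.mono (inf_le_left : u ⊓ q ⊓ (w ⊓ q) ≤ u ⊓ q)
  have h5 : (t - s) * ((v (w ⊓ p) - v (u ⊓ p ⊓ (w ⊓ p))) + (v (u ⊓ q) - v (u ⊓ q ⊓ (w ⊓ q)))) ≤
    0 := by linarith
  have h6 := nonpos_of_mul_nonpos_right h5 (sub_pos.2 hst)
  exact ⟨inf_eq_right.1 (hv.eq_of_le inf_le_right (by linarith)),
    inf_eq_left.1 (hv.eq_of_le inf_le_left (by linarith))⟩

/-- The parameters at which two different plane points have the same value. -/
def crossings (v : M → ℝ) (p q : M) : Set ℝ :=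
  {t | ∃ u ∈ metricInterval v p q, ∃ w ∈ metricInterval v p q,
    planePoint v p q u ≠ planePoint v p q w ∧ sliceValue v p q t u = sliceValue v p q t w}

theorem crossings_finite [Finite M] (v : M → ℝ) (p q : M) : (crossings v p q).Finite := by
  have : crossings v p q ⊆ ⋃ u : M, ⋃ w : M, {t | planePoint v p q u ≠ planePoint v p q w ∧
      sliceValue v p q t u = sliceValue v p q t w} := by
    rintro t ⟨u, -, w, -, h⟩
    exact Set.mem_iUnion_of_mem u (Set.mem_iUnion_of_mem w h)
  refine Set.Finite.subset ?_ this
  refine Set.finite_iUnion fun u => Set.finite_iUnion fun w => Set.Subsingleton.finite ?_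
  -- The slice values are affine in the parameter; agreeing twice, they come from the same point.
  rintro s ⟨hne, hs⟩ t ⟨-, ht⟩
  by_contra hst
  apply hne
  simp only [sliceValue] at hs ht
  have h : (s - t) * (((planePoint v p q u).2 - (planePoint v p q w).2) -
    ((planePoint v p q u).1 - (planePoint v p q w).1)) = 0 := by linarith
  have h' := (mul_eq_zero.1 h).resolve_left (sub_ne_zero.2 hst)
  have h1 : (planePoint v p q u).1 = (planePoint v p q w).1 := by
    linear_combination hs - s * h'
  exact Prod.ext h1 (by linarith)

theorem eq_planePoint_of_notMem_crossings {t : ℝ} (ht : t ∉ crossings v p q) {u w : M}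
    (hu : u ∈ metricInterval v p q) (hw : w ∈ metricInterval v p q)
    (h : sliceValue v p q t u = sliceValue v p q t w) :
    planePoint v p q u = planePoint v p q w := by
  by_contra hne
  exact ht ⟨u, hu, w, hw, hne, h⟩

/-- Equal plane points alone do not identify elements. The exchanged element is again a maximizer,
so it has the same plane point, which forces the meets of `u` and `w` with `p` and `q` to coincide.
-/
theorem Metrized.maximizer_unique [Finite M] (hv : Metrized v) {t : ℝ}
    (ht : t ∉ crossings v p q) {u w : M} (hu : u ∈ maximizers v p q t)
    (hw : w ∈ maximizers v p q t) : u = w := by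
  obtain ⟨x, hx, xp, xq⟩ := hv.exists_exchange hu.1 hw.1
  obtain ⟨y, hy, yq, yp⟩ := hv.exists_exchange (hv.interval_symm hu.1) (hv.interval_symm hw.1)
  have h1 := hu.2 x hx
  have h2 := hw.2 y (hv.interval_symm hy)
  have h3 := eq_planePoint_of_notMem_crossings ht hu.1 hw.1
    (le_antisymm (hw.2 u hu.1) (hu.2 w hw.1))
  have h4 := eq_planePoint_of_notMem_crossings ht hx hu.1 (le_antisymm h1 (by
    simp only [sliceValue, planePoint, xp, xq, yp, yq] at h2 ⊢
    linarith))
  simp only [planePoint, Prod.mk.injEq, xp, xq] at h3 h4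
  have e1 := hv.eq_of_le (inf_le_right : u ⊓ p ⊓ (w ⊓ p) ≤ w ⊓ p) (by linarith)
  have e2 := hv.eq_of_le (inf_le_left : u ⊓ q ⊓ (w ⊓ q) ≤ u ⊓ q) (by linarith)
  exact hv.eq_of_mem hu.1 hw.1 (hv.eq_of_le (inf_eq_right.1 e1) (by linarith)).symm
    (hv.eq_of_le (inf_eq_left.1 e2) (by linarith))

theorem mem_envelope_of_maximizer {t : ℝ} (h0 : 0 < t) (h1 : t < 1)
    (ht : t ∉ crossings v p q) {u : M} (hu : u ∈ maximizers v p q t) : u ∈ envelope v p q := by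
  set z := planePoint v p q u with hz
  -- An open half-plane with one boundary point added is convex; containing the hull, it makes `z`
  -- the unique maximum there.
  have hS : Convex ℝ {x : ℝ × ℝ | x = z ∨ (1 - t) * x.1 + t * x.2 < (1 - t) * z.1 + t * z.2} := by
    rw [convex_iff_forall_pos]
    intro x hx y hy a b ha hb hab
    have hle : ∀ x : ℝ × ℝ, x = z ∨ (1 - t) * x.1 + t * x.2 < (1 - t) * z.1 + t * z.2 →
        (1 - t) * x.1 + t * x.2 ≤ (1 - t) * z.1 + t * z.2 := by
      rintro x (rfl | h)
      · exact le_rfl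
      · exact h.le
    have e : ∀ c : ℝ, c = a * c + b * c := fun c => by rw [← add_mul, hab, one_mul]
    have ex := e ((1 - t) * z.1 + t * z.2)
    have lx := mul_le_mul_of_nonneg_left (hle x hx) ha.le
    have ly := mul_le_mul_of_nonneg_left (hle y hy) hb.le
    rcases hx with rfl | hx
    · rcases hy with rfl | hy
      · left; rw [← add_smul, hab, one_smul]
      · right
        have := mul_lt_mul_of_pos_left hy hb
        simp only [Prod.fst_add, Prod.snd_add, Prod.smul_fst, Prod.smul_snd, smul_eq_mul]
        linarith
    · right
      have := mul_lt_mul_of_pos_left hx ha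
      simp only [Prod.fst_add, Prod.snd_add, Prod.smul_fst, Prod.smul_snd, smul_eq_mul]
      linarith
  have hsub : convInterval v p q ⊆
      {x : ℝ × ℝ | x = z ∨ (1 - t) * x.1 + t * x.2 < (1 - t) * z.1 + t * z.2} := by
    refine convexHull_min ?_ hS
    rintro _ ⟨w, hw, rfl⟩
    rcases (hu.2 w hw).eq_or_lt with h | h
    · exact Or.inl (eq_planePoint_of_notMem_crossings ht hw hu.1 h)
    · exact Or.inr h
  refine ⟨hu.1, ?_, ?_⟩
  · rw [mem_extremePoints_iff_left]
    refine ⟨subset_convexHull ℝ _ ⟨u, hu.1, rfl⟩, ?_⟩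
    rintro x hx y hy ⟨a, b, ha, hb, hab, e⟩
    rcases hsub hx with h | h
    · exact h
    · have hy' : (1 - t) * y.1 + t * y.2 ≤ (1 - t) * z.1 + t * z.2 := by
        rcases hsub hy with h | h
        · rw [h]
        · exact h.le
      have e1 : a * x.1 + b * y.1 = z.1 := congrArg Prod.fst e
      have e2 : a * x.2 + b * y.2 = z.2 := congrArg Prod.snd e
      have l1 := mul_lt_mul_of_pos_left h ha
      have l2 := mul_le_mul_of_nonneg_left hy' hb.le
      have l3 : (1 - t) * z.1 + t * z.2 = a * ((1 - t) * z.1 + t * z.2) +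
        b * ((1 - t) * z.1 + t * z.2) := by rw [← add_mul, hab, one_mul]
      rw [← e1, ← e2] at l3
      rw [← e1, ← e2] at l1 l2
      linarith
  · intro ε h2 h3 hmem
    have p1 := mul_pos (sub_pos.2 h1) h2
    have p2 := mul_pos h0 h3
    rcases hsub hmem with h | h
    · have := congrArg Prod.fst h
      simp only [Prod.fst_add] at this
      linarith
    · simp only [Prod.fst_add, Prod.snd_add] at h
      linarith

theorem maximizer_of_no_crossing {s r t x : ℝ} (hsr : s < r) (hrt : r < t)
    (hst : Disjoint (crossings v p q) (Set.Ioo s t)) {u : M} (hu : u ∈ maximizers v p q r)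
    (hx : x ∈ Set.Icc s t) : u ∈ maximizers v p q x := by
  refine ⟨hu.1, fun w hw => ?_⟩
  by_contra! hlt
  have hr := hu.2 w hw
  set A := sliceValue v p q r u - sliceValue v p q r w with hA
  set B := sliceValue v p q x w - sliceValue v p q x u with hB
  have hA0 : 0 ≤ A := by linarith
  have hB0 : 0 < B := by linarith
  have hAB : 0 < A + B := by linarith
  -- The zero of the affine difference between `r` and `x`. Since `B > 0`, the interior point `r`
  -- has positive weight, so the zero is interior even if `x` is an endpoint.
  have hy : (B * r + A * x) / (A + B) ∈ crossings v p q := by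
    refine ⟨u, hu.1, w, hw, fun h => ?_, ?_⟩
    · rw [sliceValue, sliceValue, h] at hlt
      exact lt_irrefl _ hlt
    · simp only [sliceValue] at hA hB ⊢
      field_simp
      rw [hA, hB]
      ring
  refine Set.disjoint_left.1 hst hy ⟨?_, ?_⟩
  · rw [lt_div_iff₀ hAB]
    have := mul_lt_mul_of_pos_left hsr hB0
    have := mul_le_mul_of_nonneg_left hx.1 hA0
    linarith
  · rw [div_lt_iff₀ hAB]
    have := mul_lt_mul_of_pos_left hrt hB0
    have := mul_le_mul_of_nonneg_left hx.2 hA0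
    linarith

theorem Metrized.maximizers_nonempty [Finite M] (hv : Metrized v) (p q : M) (t : ℝ) :
    (maximizers v p q t).Nonempty :=
  Set.exists_max_image _ _ (Set.toFinite _) ⟨p, hv.left_mem_interval p q⟩

theorem Metrized.inf_left_of_maximizer_zero [Finite M] (hv : Metrized v) {u : M}
    (hu : u ∈ maximizers v p q 0) : u ⊓ p = p := by
  have h := hu.2 p (hv.left_mem_interval p q)
  simp only [sliceValue, planePoint, inf_idem] at h
  exact hv.eq_of_le inf_le_right (by linarith)

theorem Metrized.inf_right_of_maximizer_one [Finite M] (hv : Metrized v) {u : M}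
    (hu : u ∈ maximizers v p q 1) : u ⊓ q = q := by
  have h := hu.2 q (hv.interval_symm (hv.left_mem_interval q p))
  simp only [sliceValue, planePoint, inf_idem] at h
  exact hv.eq_of_le inf_le_right (by linarith)

open Classical in
/-- The part of the fractional join with parameters in `(s, t]`, evaluated at `f`. -/
noncomputable def partialJoin [Fintype M] (v f : M → ℝ) (p q : M) (s t : ℝ) : ℝ :=
  ∑ u with u ∈ envelope v p q, volume.real ({r | u ∈ maximizers v p q r} ∩ Set.Ioc s t) * f u

open Classical in
theorem partialJoin_zero_one [Fintype M] (f : M → ℝ) : partialJoin v f p q 0 1 =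
    ∑ u with u ∈ envelope v p q, coneValue (normalCone v p q u) * f u := by
  rw [partialJoin]
  refine Finset.sum_congr rfl fun u hu => ?_
  rw [coneValue_normalCone (Finset.mem_filter.1 hu).2.1]

theorem partialJoin_add [Fintype M] (f : M → ℝ) {s r t : ℝ} (hsr : s ≤ r) (hrt : r ≤ t) :
    partialJoin v f p q s r + partialJoin v f p q r t = partialJoin v f p q s t := by
  rw [partialJoin, partialJoin, partialJoin, ← Finset.sum_add_distrib]
  refine Finset.sum_congr rfl fun u _ => ?_
  rw [← add_mul]
  congr 1
  have hfin : volume ({r | u ∈ maximizers v p q r} ∩ Set.Ioc s t) ≠ ⊤ :=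
    ((measure_mono Set.inter_subset_right).trans_lt measure_Ioc_lt_top).ne
  rw [← measureReal_inter_add_sdiff (s := {r | u ∈ maximizers v p q r} ∩ Set.Ioc s t)
    (measurableSet_Ioc : MeasurableSet (Set.Ioc s r)) hfin]
  congr 2
  · rw [Set.inter_assoc, Set.inter_eq_right.2 (Set.Ioc_subset_Ioc_right hrt)]
  · rw [Set.inter_sdiff_assoc]
    congr 1
    ext x
    simp only [Set.mem_Ioc, Set.mem_sdiff, not_and, not_le]
    constructor
    · rintro ⟨h1, h2⟩
      exact ⟨⟨by linarith, h2⟩, fun _ => h1⟩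
    · rintro ⟨⟨h1, h2⟩, h3⟩
      exact ⟨h3 h1, h2⟩

theorem Metrized.partialJoin_of_no_crossing [Fintype M] (hv : Metrized v) (f : M → ℝ)
    {s r t : ℝ} (h0 : 0 ≤ s) (hsr : s < r) (hrt : r < t) (h1 : t ≤ 1)
    (hst : Disjoint (crossings v p q) (Set.Ioo s t)) {u : M} (hu : u ∈ maximizers v p q r) :
    partialJoin v f p q s t = (t - s) * f u := by
  have huE : u ∈ envelope v p q := mem_envelope_of_maximizer (by linarith) (by linarith)
    (fun h => Set.disjoint_left.1 hst h ⟨hsr, hrt⟩) hu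
  rw [partialJoin, Finset.sum_eq_single u]
  · congr 1
    have hsub : Set.Ioc s t ⊆ {r | u ∈ maximizers v p q r} :=
      fun x hx => maximizer_of_no_crossing hsr hrt hst hu ⟨hx.1.le, hx.2⟩
    rw [Set.inter_eq_right.2 hsub, Real.volume_real_Ioc_of_le (by linarith)]
  · intro w _ hwu
    have : {r | w ∈ maximizers v p q r} ∩ Set.Ioc s t ⊆ {t} := by
      rintro x ⟨hx, hsx, hxt⟩
      by_contra hne
      have hxt' : x < t := lt_of_le_of_ne hxt hne
      exact hwu (hv.maximizer_unique (fun h => Set.disjoint_left.1 hst h ⟨hsx, hxt'⟩) hx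
        (maximizer_of_no_crossing hsr hrt hst hu ⟨hsx.le, hxt⟩))
    rw [measureReal_def, measure_mono_null this (by simp)]
    simp
  · intro h
    exact absurd (by simpa using huE) h

/-- A criterion for submodularity: submodularity on the pairs `(u ∧ p, u ∧ q)` with `u ∈ I(p, q)`,
and a monotonicity property of the maximizers of a common linear functional. -/
theorem Metrized.isSubmodular [Fintype M] (hv : Metrized v) {f : M → ℝ}
    (hjoin : ∀ p q : M, ∀ u ∈ metricInterval v p q, f u + f (p ⊓ q) ≤ f (u ⊓ p) + f (u ⊓ q))
    (hcross : ∀ (p q : M) (t : ℝ) (u w : M), 0 ≤ t → t ≤ 1 → u ∈ maximizers v p q t →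
      w ∈ maximizers v p q t → w ⊓ p ≤ u ⊓ p → u ⊓ q ≤ w ⊓ q →
      (1 - t) * f (w ⊓ p) + t * f (u ⊓ q) ≤ (1 - t) * f (u ⊓ p) + t * f (w ⊓ q)) :
    IsSubmodular v f := by
  intro p q
  choose m hm using fun t => hv.maximizers_nonempty p q t
  -- The right side is the drop of the potential from `s` to `t`; induction on the number of
  -- interior crossings cuts at one of them.
  have main : ∀ (n : ℕ) (s t : ℝ), 0 ≤ s → s < t → t ≤ 1 →
      (crossings v p q ∩ Set.Ioo s t).ncard = n →
      partialJoin v f p q s t + (t - s) * f (p ⊓ q) ≤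
        ((1 - s) * f (m s ⊓ p) - s * f (m s ⊓ q)) -
        ((1 - t) * f (m t ⊓ p) - t * f (m t ⊓ q)) := by
    intro n
    induction n using Nat.strong_induction_on with
    | _ n ih =>
      intro s t h0 hst h1 hn
      rcases (crossings v p q ∩ Set.Ioo s t).eq_empty_or_nonempty with he | ⟨r, hrc, hr⟩
      · have hd := Set.disjoint_iff_inter_eq_empty.2 he
        obtain ⟨r, hsr, hrt⟩ := exists_between hst
        have hu := hm r
        rw [hv.partialJoin_of_no_crossing f h0 hsr hrt h1 hd hu]
        have us := maximizer_of_no_crossing hsr hrt hd hu ⟨le_rfl, hst.le⟩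
        have ut := maximizer_of_no_crossing hsr hrt hd hu ⟨hst.le, le_rfl⟩
        obtain ⟨a1, a2⟩ := hv.maximizers_mono hsr (hm s) hu
        obtain ⟨b1, b2⟩ := hv.maximizers_mono hrt hu (hm t)
        -- The chosen `m s` and `m t` may differ from the interior maximizer, which still maximizes
        -- at both ends; `hcross` pays for the two switches.
        have c1 := hcross p q s _ _ h0 (by linarith) (hm s) us a1 a2
        have c2 := hcross p q t _ _ (by linarith) h1 ut (hm t) b1 b2
        have c3 := mul_le_mul_of_nonneg_left (hjoin p q _ hu.1) (sub_nonneg.2 hst.le)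
        linarith
      · have hfin := (crossings_finite v p q).inter_of_left (Set.Ioo s t)
        have hl : (crossings v p q ∩ Set.Ioo s r).ncard < n := by
          rw [← hn]
          refine Set.ncard_lt_ncard ⟨Set.inter_subset_inter_right _
            (Set.Ioo_subset_Ioo_right hr.2.le), fun h => ?_⟩ hfin
          exact lt_irrefl _ (h ⟨hrc, hr⟩).2.2
        have hr' : (crossings v p q ∩ Set.Ioo r t).ncard < n := by
          rw [← hn]
          refine Set.ncard_lt_ncard ⟨Set.inter_subset_inter_right _
            (Set.Ioo_subset_Ioo_left hr.1.le), fun h => ?_⟩ hfin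
          exact lt_irrefl _ (h ⟨hrc, hr⟩).2.1
        have i1 := ih _ hl s r h0 hr.1 (by linarith [hr.2]) rfl
        have i2 := ih _ hr' r t (by linarith [hr.1]) hr.2 h1 rfl
        rw [← partialJoin_add f hr.1.le hr.2.le]
        linarith
  have h := main _ 0 1 le_rfl one_pos le_rfl rfl
  rw [hv.inf_left_of_maximizer_zero (hm 0), hv.inf_right_of_maximizer_one (hm 1)] at h
  rw [partialJoin_zero_one] at h
  linarith

end Criterion

/-! ### Submodularity of the distance -/

section DistanceSubmodular

variable {L : Type*} [SemilatticeInf L] {v : L → ℝ}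

theorem Metrized.inf_add_inf_le (hv : Metrized v) (p q u : L) :
    v (u ⊓ p) + v (u ⊓ q) ≤ v u + v (p ⊓ q) := by
  have h := hv.add_le (inf_le_left : u ⊓ p ≤ u) (inf_le_left : u ⊓ q ≤ u)
  have h1 : v (u ⊓ p ⊓ (u ⊓ q)) ≤ v (p ⊓ q) :=
    hv.mono (le_inf (inf_le_left.trans inf_le_right) (inf_le_right.trans inf_le_right))
  linarith

/-- One inequality holds in each coordinate; their sum is an equality exactly when both are. -/
theorem Metrized.mem_interval_prod_iff [Finite L] (hv : Metrized v) {p q u : L × L} :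
    u ∈ metricInterval (prodValuation v v) p q ↔
      u.1 ∈ metricInterval v p.1 q.1 ∧ u.2 ∈ metricInterval v p.2 q.2 := by
  have h1 := hv.inf_add_inf_le p.1 q.1 u.1
  have h2 := hv.inf_add_inf_le p.2 q.2 u.2
  rw [(hv.prod hv).mem_interval_iff, hv.mem_interval_iff, hv.mem_interval_iff]
  simp only [prodValuation, Prod.fst_inf, Prod.snd_inf]
  constructor
  · intro h
    constructor <;> linarith
  · rintro ⟨h, h'⟩
    linarith

theorem sliceValue_prod (p q u : L × L) (t : ℝ) :
    sliceValue (prodValuation v v) p q t u =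
      sliceValue v p.1 q.1 t u.1 + sliceValue v p.2 q.2 t u.2 := by
  simp only [sliceValue, planePoint, prodValuation, Prod.fst_inf, Prod.snd_inf]
  ring

theorem Metrized.maximizer_of_prod [Finite L] (hv : Metrized v) {p q u : L × L} {t : ℝ}
    (hu : u ∈ maximizers (prodValuation v v) p q t) :
    u.1 ∈ maximizers v p.1 q.1 t ∧ u.2 ∈ maximizers v p.2 q.2 t := by
  obtain ⟨hu, h⟩ := hu
  obtain ⟨h1, h2⟩ := hv.mem_interval_prod_iff.1 hu
  refine ⟨⟨h1, fun w hw => ?_⟩, ⟨h2, fun w hw => ?_⟩⟩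
  · have := h (w, u.2) (hv.mem_interval_prod_iff.2 ⟨hw, h2⟩)
    rw [sliceValue_prod, sliceValue_prod] at this
    simpa using this
  · have := h (u.1, w) (hv.mem_interval_prod_iff.2 ⟨h1, hw⟩)
    rw [sliceValue_prod, sliceValue_prod] at this
    simpa using this

theorem maximizers_eq {p q u w : L} {t : ℝ} (hu : u ∈ maximizers v p q t)
    (hw : w ∈ maximizers v p q t) :
    (1 - t) * v (u ⊓ p) + t * v (u ⊓ q) = (1 - t) * v (w ⊓ p) + t * v (w ⊓ q) := by
  have h := le_antisymm (hw.2 u hu.1) (hu.2 w hw.1)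
  simp only [sliceValue, planePoint] at h
  linarith

/-- Between two maximizers `u` and `w`, the meets with a bounded pair `c, d` change by at most as
much as `u ∧ p` does. -/
theorem Metrized.inf_change_le [Finite L] (hv : Metrized v) {p q u w c d : L} {t : ℝ}
    (hu : u ∈ maximizers v p q t) (hw : w ∈ maximizers v p q t) (hp : w ⊓ p ≤ u ⊓ p)
    (hq : u ⊓ q ≤ w ⊓ q) (hcd : Bounded c d) :
    (1 - t) * (v (u ⊓ p ⊓ c) - v (w ⊓ p ⊓ c)) + t * (v (w ⊓ q ⊓ d) - v (u ⊓ q ⊓ d)) ≤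
      (1 - t) * (v (u ⊓ p) - v (w ⊓ p)) := by
  have mu := hv.inf_le_of_mem hu.1
  have mw := hv.inf_le_of_mem hw.1
  obtain ⟨e, hce, hde⟩ := hcd
  obtain ⟨a, wa, ua, ha, ea⟩ := hv.exists_join (w ⊓ p) (u ⊓ p ⊓ c) (u ⊓ p) hp inf_le_left
  obtain ⟨b, ub, wb, hb, eb⟩ := hv.exists_join (u ⊓ q) (w ⊓ q ⊓ d) (w ⊓ q) hq inf_le_left
  have hap := ha (u ⊓ p) hp inf_le_left
  have hbq := hb (w ⊓ q) hq inf_le_left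
  have b1 : Bounded a (u ⊓ q) := ⟨u, hap.trans inf_le_left, inf_le_left⟩
  have b2 : Bounded b (w ⊓ p) := ⟨w, hbq.trans inf_le_left, inf_le_left⟩
  have b3 : Bounded (w ⊓ p) (u ⊓ p ⊓ c) := ⟨u ⊓ p, hp, inf_le_left⟩
  have b4 : Bounded (u ⊓ p ⊓ c) (w ⊓ q ⊓ d) :=
    ⟨e, inf_le_right.trans hce, inf_le_right.trans hde⟩
  have b5 : Bounded (w ⊓ q ⊓ d) (w ⊓ p) := ⟨w, inf_le_left.trans inf_le_left, inf_le_left⟩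
  obtain ⟨x, x1, x2, x3⟩ := hv.bounded_triple _ _ _ b3 b4 b5
  have b6 : Bounded (w ⊓ q ⊓ d) a := ⟨x, x3, ha x x1 x2⟩
  have b7 : Bounded (u ⊓ q) (w ⊓ q ⊓ d) := ⟨w ⊓ q, hq, inf_le_left⟩
  -- A second use of the triple condition bounds `a` with `b`, so they are the meets of some `z` in
  -- the interval; `z` is then compared with the maximizer `w`.
  obtain ⟨y, y1, y2, y3⟩ := hv.bounded_triple _ _ _ b1 b7 b6
  obtain ⟨z, hz, zp, zq⟩ := hv.exists_mem_interval (hap.trans inf_le_right)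
    (hbq.trans inf_le_right) ((le_inf mw inf_le_left).trans wa)
    ((le_inf mu inf_le_right).trans ub) ⟨y, y1, hb y y2 y3⟩
  have h := hw.2 z hz
  have h' := maximizers_eq hu hw
  rw [← inf_assoc, inf_eq_left.2 hp] at ea
  rw [← inf_assoc, inf_eq_left.2 hq] at eb
  simp only [sliceValue, planePoint, zp, zq] at h
  have ea' : v (u ⊓ p ⊓ c) - v (w ⊓ p ⊓ c) = v a - v (w ⊓ p) := by linarith
  have eb' : v (w ⊓ q ⊓ d) - v (u ⊓ q ⊓ d) = v b - v (u ⊓ q) := by linarith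
  rw [ea', eb']
  linarith

theorem Metrized.isSubmodular_valDist [Fintype L] (hv : Metrized v) :
    IsSubmodular (prodValuation v v) (fun x : L × L => valDist v x.1 x.2) := by
  apply (hv.prod hv).isSubmodular
  · intro p q u hu
    rw [(hv.prod hv).mem_interval_iff] at hu
    have h := hv.add_le
      (inf_le_inf inf_le_left inf_le_left : u.1 ⊓ p.1 ⊓ (u.2 ⊓ p.2) ≤ u.1 ⊓ u.2)
      (inf_le_inf inf_le_left inf_le_left : u.1 ⊓ q.1 ⊓ (u.2 ⊓ q.2) ≤ u.1 ⊓ u.2)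
    have h' : v (u.1 ⊓ p.1 ⊓ (u.2 ⊓ p.2) ⊓ (u.1 ⊓ q.1 ⊓ (u.2 ⊓ q.2))) ≤
        v (p.1 ⊓ q.1 ⊓ (p.2 ⊓ q.2)) :=
      hv.mono ((inf_inf_inf_comm _ _ _ _).trans_le (inf_le_inf (inf_le_inf inf_le_right inf_le_right)
        (inf_le_inf inf_le_right inf_le_right)))
    simp only [valDist, prodValuation, Prod.fst_inf, Prod.snd_inf] at hu ⊢
    linarith
  · intro p q t u w _ _ hu hw hp hq
    obtain ⟨u1, u2⟩ := hv.maximizer_of_prod hu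
    obtain ⟨w1, w2⟩ := hv.maximizer_of_prod hw
    -- First coordinate 1 passes from `u` to `w` against the meets of `u.2`, then coordinate 2
    -- against those of `w.1`; the mixed meets cancel in the sum.
    have h1 := hv.inf_change_le u1 w1 hp.1 hq.1
      (⟨u.2, inf_le_left, inf_le_left⟩ : Bounded (u.2 ⊓ p.2) (u.2 ⊓ q.2))
    have h2 := hv.inf_change_le u2 w2 hp.2 hq.2
      (⟨w.1, inf_le_left, inf_le_left⟩ : Bounded (w.1 ⊓ p.1) (w.1 ⊓ q.1))
    have e1 := maximizers_eq u1 w1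
    have e2 := maximizers_eq u2 w2
    rw [inf_comm (u.2 ⊓ p.2), inf_comm (w.2 ⊓ p.2), inf_comm (w.2 ⊓ q.2),
      inf_comm (u.2 ⊓ q.2)] at h2
    simp only [valDist, Prod.fst_inf, Prod.snd_inf]
    linarith

end DistanceSubmodular

end ModularSemilattice

theorem mainTheorem5 {L : Type*} [SemilatticeInf L] [OrderBot L] [Fintype L]
    (hL : ModularSemilattice.IsModularSemilattice L) (v : L → ℝ)
    (hv : ModularSemilattice.IsValuation v) :
    ModularSemilattice.IsSubmodular (ModularSemilattice.prodValuation v v)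
      (fun x : L × L => ModularSemilattice.pathDist v x.1 x.2) := by
  have h := hv.metrized hL
  simpa only [h.pathDist_eq] using h.isSubmodular_valDist
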